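/- **Theorem 3.1.** Let $K$ be a commutative ring (for example a differential field, or the ring of smooth functions on a coordinate domain of $\mathbb{R}^n$) with $n$ commuting derivations $\partial_1,\dots,\partial_n$, and let $K[d_1,\dots,d_n]$ be the ring of linear differential operators with coefficients in $K$: it is generated by $K$ and by $d_1,\dots,d_n$, subject to $d_id_j=d_jd_i$ and $d_i a=a\,d_i+\partial_i a$ for $a\in K$. A linear differential operator from $m$ unknowns to $q$ unknowns is a $q\times m$ matrix over this ring, and composition is the matrix product. The formal adjoint $ad(\mathcal{A})$ of a matrix $\mathcal{A}$ is its transpose with each entry $\sum_\alpha a_\alpha d^\alpha$ replaced by $\sum_\alpha(-1)^{|\alpha|}d^\alpha a_\alpha$. For operators $\mathcal{A},\mathcal{B}$ with the same source, write $\mathcal{A}\le\mathcal{B}$ if $\mathcal{A}=\mathcal{Q}\circ\mathcal{B}$ for some operator $\mathcal{Q}$; the equality $\mathcal{A}=\mathcal{B}$ below is understood as $\mathcal{A}\le\mathcal{B}$ and $\mathcal{B}\le\mathcal{A}$. An operator $\mathcal{A}_1$ *generates the compatibility conditions* (CC) of $\mathcal{A}$, or is *parametrized by* $\mathcal{A}$,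 if $\mathcal{A}_1\circ\mathcal{A}=0$ and every operator $\mathcal{B}$ with $\mathcal{B}\circ\mathcal{A}=0$ satisfies $\mathcal{B}\le\mathcal{A}_1$. Let $\mathcal{D}_1$ be an operator, let $\mathcal{D}$ be an operator such that $ad(\mathcal{D})$ generates the CC of $ad(\mathcal{D}_1)$, and let $\mathcal{D}_1'$ be an operator generating the CC of $\mathcal{D}$. Then $\mathcal{D}_1\circ\mathcal{D}=0$ and $\mathcal{D}_1\le\mathcal{D}_1'$, and $$\mathcal{D}_1\text{ is parametrized by }\mathcal{D}\iff\mathcal{D}_1=\mathcal{D}_1'.$$ Moreover, $\mathcal{D}_1$ is parametrized by some operator if and only if $\mathcal{D}_1=\mathcal{D}_1'$. -/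

import Mathlib

universe u

/-- `n` pairwise commuting derivations `∂₁, …, ∂ₙ` of a commutative ring `K`, which make `K` a
(partial) differential ring. `K` may be a differential field, or the ring of smooth functions on a
coordinate domain of `ℝⁿ`. -/
structure CommDerivations (K : Type u) [CommRing K] (n : ℕ) where
  der : Fin n → Derivation ℤ K K
  comm : ∀ (i j : Fin n) (a : K), der i (der j a) = der j (der i a)

namespace CommDerivations

variable {K : Type u} [CommRing K] {n : ℕ} (δ : CommDerivations K n)

/-- The defining relations of the ring of differential operators: the generators `ι (inl a)` form
a copy of the ring `K`, the generators `dᵢ = ι (inr i)` commute with each other, and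
`dᵢ a = a dᵢ + ∂ᵢ a`. -/
inductive Rel : FreeAlgebra ℤ (K ⊕ Fin n) → FreeAlgebra ℤ (K ⊕ Fin n) → Prop
  | one : Rel (FreeAlgebra.ι ℤ (Sum.inl 1)) 1
  | add (a b : K) : Rel (FreeAlgebra.ι ℤ (Sum.inl (a + b)))
      (FreeAlgebra.ι ℤ (Sum.inl a) + FreeAlgebra.ι ℤ (Sum.inl b))
  | mul (a b : K) : Rel (FreeAlgebra.ι ℤ (Sum.inl (a * b)))
      (FreeAlgebra.ι ℤ (Sum.inl a) * FreeAlgebra.ι ℤ (Sum.inl b))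
  | comm (i j : Fin n) : Rel (FreeAlgebra.ι ℤ (Sum.inr i) * FreeAlgebra.ι ℤ (Sum.inr j))
      (FreeAlgebra.ι ℤ (Sum.inr j) * FreeAlgebra.ι ℤ (Sum.inr i))
  | leibniz (i : Fin n) (a : K) : Rel (FreeAlgebra.ι ℤ (Sum.inr i) * FreeAlgebra.ι ℤ (Sum.inl a))
      (FreeAlgebra.ι ℤ (Sum.inl a) * FreeAlgebra.ι ℤ (Sum.inr i)
        + FreeAlgebra.ι ℤ (Sum.inl (δ.der i a)))

/-- The ring `K[d₁, …, dₙ]` of linear differential operators with coefficients in `K`; the product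
is the composition of operators. -/
def DiffOp : Type u := RingQuot δ.Rel

noncomputable instance : Ring δ.DiffOp := inferInstanceAs (Ring (RingQuot δ.Rel))

noncomputable instance : Algebra ℤ δ.DiffOp := inferInstanceAs (Algebra ℤ (RingQuot δ.Rel))

/-- The quotient map onto the ring of differential operators. -/
noncomputable def proj : FreeAlgebra ℤ (K ⊕ Fin n) →ₐ[ℤ] δ.DiffOp := RingQuot.mkAlgHom ℤ δ.Rel

/-- The operator of order zero "multiplication by `a`". -/
noncomputable def coeff (a : K) : δ.DiffOp := δ.proj (FreeAlgebra.ι ℤ (Sum.inl a))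

/-- The operator `dᵢ`. -/
noncomputable def d (i : Fin n) : δ.DiffOp := δ.proj (FreeAlgebra.ι ℤ (Sum.inr i))

theorem proj_rel {x y : FreeAlgebra ℤ (K ⊕ Fin n)} (h : δ.Rel x y) : δ.proj x = δ.proj y :=
  RingQuot.mkAlgHom_rel ℤ h

theorem coeff_one : δ.coeff 1 = 1 := by
  have h := δ.proj_rel Rel.one
  rwa [map_one] at h

theorem coeff_add (a b : K) : δ.coeff (a + b) = δ.coeff a + δ.coeff b := by
  have h := δ.proj_rel (Rel.add a b)
  rwa [map_add] at h

theorem coeff_mul (a b : K) : δ.coeff (a * b) = δ.coeff a * δ.coeff b := by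
  have h := δ.proj_rel (Rel.mul a b)
  rwa [map_mul] at h

theorem d_comm (i j : Fin n) : δ.d i * δ.d j = δ.d j * δ.d i := by
  have h := δ.proj_rel (Rel.comm i j)
  rwa [map_mul, map_mul] at h

theorem d_mul_coeff (i : Fin n) (a : K) :
    δ.d i * δ.coeff a = δ.coeff a * δ.d i + δ.coeff (δ.der i a) := by
  have h := δ.proj_rel (Rel.leibniz i a)
  rwa [map_add, map_mul, map_mul] at h

/-- Values of the formal adjoint on the generators: `a ↦ a` and `dᵢ ↦ -dᵢ`. -/
noncomputable def adGen : K ⊕ Fin n → δ.DiffOpᵐᵒᵖ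
  | Sum.inl a => MulOpposite.op (δ.coeff a)
  | Sum.inr i => MulOpposite.op (-δ.d i)

theorem adGen_rel ⦃x y : FreeAlgebra ℤ (K ⊕ Fin n)⦄ (h : δ.Rel x y) :
    FreeAlgebra.lift ℤ δ.adGen x = FreeAlgebra.lift ℤ δ.adGen y := by
  induction h with
  | one => simp [adGen, coeff_one]
  | add a b => simp [adGen, coeff_add]
  | mul a b =>
    simp only [map_mul, FreeAlgebra.lift_ι_apply, adGen, ← MulOpposite.op_mul, ← coeff_mul]
    rw [mul_comm]
  | comm i j =>
    simp only [map_mul, FreeAlgebra.lift_ι_apply, adGen, ← MulOpposite.op_mul, neg_mul_neg]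
    rw [d_comm]
  | leibniz i a =>
    simp only [map_add, map_mul, FreeAlgebra.lift_ι_apply, adGen, ← MulOpposite.op_mul,
      ← MulOpposite.op_add]
    rw [neg_mul, mul_neg, d_mul_coeff]
    congr 1
    abel

/-- The formal adjoint of scalar operators as a ring homomorphism to the opposite ring. -/
noncomputable def adHom : δ.DiffOp →ₐ[ℤ] δ.DiffOpᵐᵒᵖ :=
  RingQuot.liftAlgHom ℤ ⟨FreeAlgebra.lift ℤ δ.adGen, δ.adGen_rel⟩

/-- The formal adjoint of a scalar operator,
`∑ a_α d^α ↦ ∑ (-1)^|α| d^α a_α` (integration by parts). -/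
noncomputable def ad₀ (P : δ.DiffOp) : δ.DiffOp := (δ.adHom P).unop

theorem ad₀_coeff (a : K) : δ.ad₀ (δ.coeff a) = δ.coeff a := by
  have h : δ.adHom (δ.proj (FreeAlgebra.ι ℤ (Sum.inl a))) = δ.adGen (Sum.inl a) := by
    rw [adHom, proj]
    erw [RingQuot.liftAlgHom_mkAlgHom_apply]
    rw [FreeAlgebra.lift_ι_apply]
  rw [ad₀, coeff, h]
  rfl

theorem ad₀_d (i : Fin n) : δ.ad₀ (δ.d i) = -δ.d i := by
  have h : δ.adHom (δ.proj (FreeAlgebra.ι ℤ (Sum.inr i))) = δ.adGen (Sum.inr i) := by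
    rw [adHom, proj]
    erw [RingQuot.liftAlgHom_mkAlgHom_apply]
    rw [FreeAlgebra.lift_ι_apply]
  rw [ad₀, d, h]
  rfl

theorem ad₀_mul (P Q : δ.DiffOp) : δ.ad₀ (P * Q) = δ.ad₀ Q * δ.ad₀ P := by
  simp [ad₀]

/-- A linear differential operator from sections of a (trivialized) bundle of rank `m` to sections
of one of rank `q`, written as a `q × m` matrix. Composition is the matrix product. -/
abbrev Op (q m : ℕ) : Type u := Matrix (Fin q) (Fin m) δ.DiffOp

variable {δ}

/-- The formal adjoint of a matrix operator: transpose and take adjoints of the entries. -/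
noncomputable def ad {q m : ℕ} (A : δ.Op q m) : δ.Op m q :=
  Matrix.of fun j i => δ.ad₀ (A i j)

/-- `A ≤ B` for operators with the same source: the equations `A η = 0` are differential
consequences of the equations `B η = 0`, i.e. `A = Q ∘ B` for some operator `Q`. -/
def Precedes {q r m : ℕ} (A : δ.Op q m) (B : δ.Op r m) : Prop :=
  ∃ Q : δ.Op q r, A = Q * B

/-- Equality of operators as systems of equations: `A ≤ B` and `B ≤ A`. -/
def SameSystem {q r m : ℕ} (A : δ.Op q m) (B : δ.Op r m) : Prop :=
  Precedes A B ∧ Precedes B A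

/-- `A₁` generates the compatibility conditions of `A`: it is itself a compatibility condition
(`A₁ ∘ A = 0`), and every operator `B` with `B ∘ A = 0` factors through `A₁`. One also says that
`A₁` is parametrized by `A`. -/
def GeneratesCC {q m p : ℕ} (A₁ : δ.Op q m) (A : δ.Op m p) : Prop :=
  A₁ * A = 0 ∧ ∀ (r : ℕ) (B : δ.Op r m), B * A = 0 → Precedes B A₁

end CommDerivations

namespace CommDerivations

section Adjoint

variable {K : Type u} [CommRing K] {n : ℕ} {δ : CommDerivations K n}

/-! The formal adjoint is an involution that reverses products (`ad_ad`, `ad_mul`), so it exchanges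
left and right factors. The hypothesis on `ad D` therefore says that `D₁ * D = 0` and that every `E`
with `D₁ * E = 0` has the form `D * R`. Any parametrization `E` of `D₁` thus factors through `D`, so
whatever annihilates `D` annihilates `E`; in particular `D₁'` does, which forces `D₁' ≤ D₁`.
Conversely, generating the CC depends only on the system up to mutual `≤`, so `D` itself
parametrizes `D₁` as soon as `D₁ = D₁'`. -/

theorem ad₀_zero : δ.ad₀ 0 = 0 := by
  simp [ad₀]

theorem ad₀_add (P Q : δ.DiffOp) : δ.ad₀ (P + Q) = δ.ad₀ P + δ.ad₀ Q := by
  simp [ad₀]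

theorem ad₀_neg (P : δ.DiffOp) : δ.ad₀ (-P) = -δ.ad₀ P := by
  simp [ad₀]

theorem ad₀_intCast (k : ℤ) : δ.ad₀ (k : δ.DiffOp) = k := by
  simp [ad₀]

theorem ad₀_sum {ι : Type*} (s : Finset ι) (f : ι → δ.DiffOp) :
    δ.ad₀ (∑ i ∈ s, f i) = ∑ i ∈ s, δ.ad₀ (f i) := by
  simp [ad₀]

theorem proj_surjective : Function.Surjective δ.proj :=
  RingQuot.mkAlgHom_surjective ℤ δ.Rel

/-- The formal adjoint of scalar operators is an involution. -/
theorem ad₀_ad₀ (P : δ.DiffOp) : δ.ad₀ (δ.ad₀ P) = P := by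
  -- Applying an anti-homomorphism twice preserves products, so generators suffice. Elements of `K`
  -- are generators here; the scalars are only integers.
  obtain ⟨x, rfl⟩ := proj_surjective P
  induction x using FreeAlgebra.induction with
  | grade0 r =>
    rw [eq_intCast (algebraMap ℤ (FreeAlgebra ℤ (K ⊕ Fin n))) r, map_intCast]
    rw [ad₀_intCast, ad₀_intCast]
  | grade1 g =>
    cases g with
    | inl a =>
      change δ.ad₀ (δ.ad₀ (δ.coeff a)) = δ.coeff a
      rw [ad₀_coeff, ad₀_coeff]
    | inr i =>
      change δ.ad₀ (δ.ad₀ (δ.d i)) = δ.d i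
      rw [ad₀_d, ad₀_neg, ad₀_d, neg_neg]
  | mul x y hx hy => rw [map_mul, ad₀_mul, ad₀_mul, hx, hy]
  | add x y hx hy => rw [map_add, ad₀_add, ad₀_add, hx, hy]

theorem ad_ad {q m : ℕ} (A : δ.Op q m) : ad (ad A) = A := by
  ext i j
  exact ad₀_ad₀ (A i j)

theorem ad_zero {q m : ℕ} : ad (0 : δ.Op q m) = 0 := by
  ext i j
  exact ad₀_zero

theorem ad_mul {q r m : ℕ} (A : δ.Op q r) (B : δ.Op r m) : ad (A * B) = ad B * ad A := by
  ext i j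
  simp only [ad, Matrix.of_apply, Matrix.mul_apply, ad₀_sum, ad₀_mul]

theorem ad_mul_ad_eq_zero_iff {q r m : ℕ} (A : δ.Op q r) (B : δ.Op r m) :
    ad B * ad A = 0 ↔ A * B = 0 := by
  rw [← ad_mul]
  refine ⟨fun h => ?_, fun h => by rw [h, ad_zero]⟩
  rw [← ad_ad (A * B), h, ad_zero]

theorem Precedes.trans {q r s m : ℕ} {A : δ.Op q m} {B : δ.Op r m} {C : δ.Op s m}
    (hAB : Precedes A B) (hBC : Precedes B C) : Precedes A C := by
  obtain ⟨P, rfl⟩ := hAB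
  obtain ⟨Q, rfl⟩ := hBC
  exact ⟨P * Q, (Matrix.mul_assoc P Q C).symm⟩

/-- This dualizes the universal property assumed of `ad D` into one of `D`: taking adjoints moves
the factor to the right. -/
theorem Precedes.exists_eq_mul_of_ad {m p s : ℕ} {E : δ.Op m s} {D : δ.Op m p}
    (h : Precedes (ad E) (ad D)) : ∃ R : δ.Op p s, E = D * R := by
  obtain ⟨Q, hQ⟩ := h
  exact ⟨ad Q, by rw [← ad_ad E, hQ, ad_mul, ad_ad]⟩

/-- A system equal to one that generates the compatibility conditions generates them too. -/
theorem GeneratesCC.of_sameSystem {q q' m p : ℕ} {A : δ.Op q m} {B : δ.Op q' m} {D : δ.Op m p}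
    (hB : GeneratesCC B D) (h : SameSystem A B) : GeneratesCC A D := by
  refine ⟨?_, fun r C hC => (hB.2 r C hC).trans h.2⟩
  obtain ⟨Q, rfl⟩ := h.1
  rw [Matrix.mul_assoc, hB.1, Matrix.mul_zero]

end Adjoint

end CommDerivations

theorem theorem3p1 {K : Type u} [CommRing K] {n : ℕ} (δ : CommDerivations K n)
    {p m q q' : ℕ} (D₁ : δ.Op q m) (D : δ.Op m p) (D₁' : δ.Op q' m)
    (hD : CommDerivations.GeneratesCC (CommDerivations.ad D) (CommDerivations.ad D₁))
    (hD₁' : CommDerivations.GeneratesCC D₁' D) :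
    D₁ * D = 0 ∧ CommDerivations.Precedes D₁ D₁' ∧
      (CommDerivations.GeneratesCC D₁ D ↔ CommDerivations.SameSystem D₁ D₁') ∧
      ((∃ (s : ℕ) (E : δ.Op m s), CommDerivations.GeneratesCC D₁ E) ↔
        CommDerivations.SameSystem D₁ D₁') := by
  have h₀ : D₁ * D = 0 := (CommDerivations.ad_mul_ad_eq_zero_iff D₁ D).1 hD.1
  have hle : CommDerivations.Precedes D₁ D₁' := hD₁'.2 q D₁ h₀
  have hpar : ∀ (s : ℕ) (E : δ.Op m s), CommDerivations.GeneratesCC D₁ E →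
      CommDerivations.SameSystem D₁ D₁' := by
    intro s E hE
    obtain ⟨R, rfl⟩ :=
      (hD.2 s _ ((CommDerivations.ad_mul_ad_eq_zero_iff D₁ E).2 hE.1)).exists_eq_mul_of_ad
    -- With `E = D * R`, `D₁'` is a compatibility condition of `E`, because `D₁' * D = 0`.
    refine ⟨hle, hE.2 q' D₁' ?_⟩
    rw [← Matrix.mul_assoc, hD₁'.1, Matrix.zero_mul]
  exact ⟨h₀, hle, ⟨hpar p D, hD₁'.of_sameSystem⟩,
    ⟨fun ⟨s, E, hE⟩ => hpar s E hE, fun h => ⟨p, D, hD₁'.of_sameSystem h⟩⟩⟩
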